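/- Let $0<m<n$ be integers. Let $\mathrm{Gr}(n,m)$ be the Grassmannian of $m$-dimensional linear subspaces of $\mathbb{R}^n$, with the topology of the metric $\|P_V-P_W\|$ ($P_V$ being the orthogonal projection onto $V$, seen as an endomorphism of $\mathbb{R}^n$), and let $\gamma_{n,m}$ be its orthogonally invariant Borel probability measure, i.e. the image of the Haar probability measure of $O(n)$ under $g\mapsto g(V_0)$ for a fixed $m$-plane $V_0$. For $V\in\mathrm{Gr}(n,m)$ let $\pi_V\colon\mathbb{R}^n\to V$ be the orthogonal projection. For a finite Borel measure $\mu$ on $\mathbb{R}^n$ let $\pi_V\mu$ be the push-forward of $\mu$ under $\pi_V$, and let $(\pi_V\mu)^a$ be the absolutely continuous part of $\pi_V\mu$ with respect to the Hausdorff measure $\mathcal{H}^m$ on $V$. **Theorem 1.3 (Injectivity of projections).** Let $\mu$ be a finite Borel measure on $\mathbb{R}^n$ and let $\Sigma\subset\mathrm{Gr}(n,m)$ be a Borel set. Then at least one of the following two alternatives holds: 1. for $\gamma_{n,m}$-a.e. $V\in\Sigma$, the map $\pi_V\colon\mathbb{R}^n\to V$ is injective on a set of full $\mu$-measure, i.e.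 there is a Borel set $E\subset\mathbb{R}^n$ with $\mu(\mathbb{R}^n\setminus E)=0$ on which $\pi_V$ is injective; 2. $\gamma_{n,m}\bigl(\{V\in\Sigma : (\pi_V\mu)^a\neq 0\}\bigr)>0$. Equivalently, if $\pi_V\mu\perp\mathcal{H}^m$ for $\gamma_{n,m}$-a.e. $V\in\Sigma$, then for $\gamma_{n,m}$-a.e. $V\in\Sigma$ the map $\pi_V$ is injective on a set of full $\mu$-measure. -/

import Mathlib

open MeasureTheory

/-- The Grassmannian `Gr(n,m)` of `m`-dimensional linear subspaces of `ℝⁿ`. -/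
def Gr (n m : ℕ) : Type :=
  {V : Submodule ℝ (EuclideanSpace ℝ (Fin n)) // Module.finrank ℝ V = m}

namespace Gr

/-- The usual topology of `Gr(n,m)`: the one of the metric `‖P_V - P_W‖`, where `P_V` is the
orthogonal projection onto `V`, seen as an endomorphism of `ℝⁿ`. -/
noncomputable instance (n m : ℕ) : TopologicalSpace (Gr n m) :=
  TopologicalSpace.induced (fun V : Gr n m => V.1.starProjection) inferInstance

/-- The Borel sets of `Gr(n,m)`. -/
noncomputable instance (n m : ℕ) : MeasurableSpace (Gr n m) := borel _

instance (n m : ℕ) : BorelSpace (Gr n m) := ⟨rfl⟩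

end Gr

/-- The orthogonal group `O(n)` of `ℝⁿ`, with the topology of the operator norm. -/
abbrev OrthGroup (n : ℕ) : Type :=
  unitary (EuclideanSpace ℝ (Fin n) →L[ℝ] EuclideanSpace ℝ (Fin n))

namespace OrthGroup

instance continuousStar (n : ℕ) :
    ContinuousStar (EuclideanSpace ℝ (Fin n) →L[ℝ] EuclideanSpace ℝ (Fin n)) :=
  ⟨(ContinuousLinearMap.adjoint (𝕜 := ℝ) (E := EuclideanSpace ℝ (Fin n))
    (F := EuclideanSpace ℝ (Fin n))).continuous⟩

instance compactSpace (n : ℕ) : CompactSpace (OrthGroup n) := by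
  refine isCompact_iff_compactSpace.1 ((isCompact_closedBall
    (0 : EuclideanSpace ℝ (Fin n) →L[ℝ] EuclideanSpace ℝ (Fin n)) 1).of_isClosed_subset
    isClosed_unitary fun u hu => ?_)
  rw [mem_closedBall_zero_iff]
  refine ContinuousLinearMap.opNorm_le_bound _ zero_le_one fun x => ?_
  rw [one_mul]
  exact (Unitary.norm_map ⟨u, hu⟩ x).le

/-- The Haar probability measure `θ_n` of the compact group `O(n)`. -/
noncomputable def haar (n : ℕ) : Measure (OrthGroup n) := Measure.haarMeasure ⊤

/-- The action of `O(n)` on `Gr(n,m)`, `(g, V) ↦ g(V)`. -/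
noncomputable def act {n m : ℕ} (g : OrthGroup n) (V : Gr n m) : Gr n m :=
  ⟨V.1.map (Unitary.linearIsometryEquiv g).toLinearEquiv.toLinearMap,
    ((Unitary.linearIsometryEquiv g).toLinearEquiv.finrank_map_eq V.1).trans V.2⟩

theorem continuous_act {n m : ℕ} (V : Gr n m) : Continuous fun g : OrthGroup n => act g V := by
  refine continuous_induced_rng.2 ?_
  have : ((fun W : Gr n m => W.1.starProjection) ∘ fun g : OrthGroup n => act g V)
      = fun g : OrthGroup n => g.1 * V.1.starProjection * star g.1 := by
    funext g
    ext1 x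
    exact Submodule.starProjection_map_apply (Unitary.linearIsometryEquiv g) V.1 x
  rw [this]
  fun_prop

end OrthGroup

/-- The coordinate plane spanned by the first `m` standard basis vectors of `ℝⁿ`. -/
noncomputable def Gr.coord {n m : ℕ} (h : m ≤ n) : Gr n m :=
  ⟨Submodule.span ℝ (Set.range fun i : Fin m => EuclideanSpace.single (Fin.castLE h i) (1 : ℝ)), by
    have hli : LinearIndependent ℝ
        fun i : Fin m => EuclideanSpace.single (Fin.castLE h i) (1 : ℝ) :=
      (EuclideanSpace.orthonormal_single.linearIndependent).comp _ (Fin.castLE_injective h)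
    simpa using finrank_span_eq_card hli⟩

/-- The measure `γ_{n,m}`, the orthogonally invariant Borel probability measure on `Gr(n,m)`:
`γ_{n,m}(A) = θ_n {g ∈ O(n) : g(V₀) ∈ A}`, with `V₀` the coordinate `m`-plane. -/
noncomputable def Gr.gamma {n m : ℕ} (h : m ≤ n) : Measure (Gr n m) :=
  (OrthGroup.haar n).map fun g => OrthGroup.act g (Gr.coord h)

/-- The orthogonal projection `π_V : ℝⁿ → V`. -/
noncomputable def Gr.proj {n m : ℕ} (V : Gr n m) : EuclideanSpace ℝ (Fin n) → V.1 :=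
  fun x => V.1.orthogonalProjectionOnto x

/-- The `m`-dimensional Hausdorff measure on the `m`-plane `V`. -/
noncomputable def Gr.hausdorff {n m : ℕ} (V : Gr n m) : Measure V.1 :=
  Measure.hausdorffMeasure (m : ℝ)

/-- `H^m` is `σ`-finite on `V`, so that the Lebesgue decomposition with respect to it exists. -/
instance Gr.sigmaFinite_hausdorff {n m : ℕ} (V : Gr n m) : SigmaFinite V.hausdorff := by
  have h := V.2
  have : V.hausdorff = Measure.hausdorffMeasure (Module.finrank ℝ V.1 : ℝ) := by
    rw [h]; rfl
  rw [this]
  infer_instance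

/-- The push-forward `π_V μ`, a measure on `V`. -/
noncomputable def Gr.projMeasure {n m : ℕ} (V : Gr n m)
    (μ : Measure (EuclideanSpace ℝ (Fin n))) : Measure V.1 :=
  μ.map V.proj

/-- `(π_V μ)^a`, the absolutely continuous part of `π_V μ` with respect to `H^m`. -/
noncomputable def Gr.acPart {n m : ℕ} (V : Gr n m)
    (μ : Measure (EuclideanSpace ℝ (Fin n))) : Measure V.1 :=
  V.hausdorff.withDensity ((V.projMeasure μ).rnDeriv V.hausdorff)

/-- `π_V` is injective on a (Borel) set of full `μ`-measure. -/
def Gr.InjOnFullMeasure {n m : ℕ} (V : Gr n m)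
    (μ : Measure (EuclideanSpace ℝ (Fin n))) : Prop :=
  ∃ E : Set (EuclideanSpace ℝ (Fin n)), MeasurableSet E ∧ μ Eᶜ = 0 ∧ Set.InjOn V.proj E

open Filter Topology
open scoped ENNReal

namespace OrthGroup

instance isProbabilityMeasure_haar (n : ℕ) : IsProbabilityMeasure (haar n) :=
  ⟨Measure.haarMeasure_self (K₀ := (⊤ : TopologicalSpace.PositiveCompacts (OrthGroup n)))⟩

instance isMulLeftInvariant_haar (n : ℕ) : (haar n).IsMulLeftInvariant := by
  unfold haar; infer_instance

/-- `O(n)` acts transitively on the spheres. -/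
theorem exists_apply_eq {n : ℕ} {v w : EuclideanSpace ℝ (Fin n)} (h : ‖v‖ = ‖w‖) :
    ∃ g : OrthGroup n, g.1 v = w := by
  refine ⟨Unitary.linearIsometryEquiv.symm (Submodule.reflection (ℝ ∙ (v - w))ᗮ), ?_⟩
  simpa using Submodule.reflection_sub h

theorem norm_starProjection_act {n m : ℕ} (g : OrthGroup n) (V : Gr n m)
    (v : EuclideanSpace ℝ (Fin n)) :
    ‖(act g V).1.starProjection v‖ = ‖V.1.starProjection ((g⁻¹).1 v)‖ := by
  have h : (act g V).1.starProjection v = g.1 (V.1.starProjection ((g⁻¹).1 v)) :=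
    Submodule.starProjection_map_apply (Unitary.linearIsometryEquiv g) V.1 v
  rw [h]
  exact Unitary.norm_map g _

/-- Longer vectors have a small projection less often. -/
theorem haar_norm_starProjection_le_mono {n m : ℕ} (V : Gr n m)
    {v w : EuclideanSpace ℝ (Fin n)} (hwv : ‖w‖ ≤ ‖v‖) (r : ℝ) :
    haar n {g | ‖V.1.starProjection ((g⁻¹).1 v)‖ ≤ r} ≤
      haar n {g | ‖V.1.starProjection ((g⁻¹).1 w)‖ ≤ r} := by
  rcases eq_or_ne v 0 with rfl | hv
  · have : w = 0 := by simpa using hwv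
    rw [this]
  have hv' : 0 < ‖v‖ := norm_pos_iff.2 hv
  set c : ℝ := ‖w‖ / ‖v‖ with hc
  have hc0 : 0 ≤ c := by positivity
  have hc1 : c ≤ 1 := div_le_one_of_le₀ hwv hv'.le
  obtain ⟨h, hh⟩ := exists_apply_eq (v := c • v) (w := w) (by
    rw [norm_smul, Real.norm_of_nonneg hc0, hc, div_mul_cancel₀ _ hv'.ne'])
  rw [← measure_preimage_mul (haar n) h {g | ‖V.1.starProjection ((g⁻¹).1 w)‖ ≤ r}]
  refine measure_mono fun g hg => ?_
  have key : (((h * g)⁻¹ : OrthGroup n)).1 w = c • (g⁻¹).1 v := by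
    have h1 : (h⁻¹).1 w = c • v := by
      rw [← hh]
      exact congrArg (fun u : OrthGroup n => u.1 (c • v)) (inv_mul_cancel h)
    rw [mul_inv_rev]
    change (g⁻¹).1 ((h⁻¹).1 w) = _
    rw [h1, map_smul]
  simp only [Set.mem_preimage, Set.mem_ofPred_eq] at hg ⊢
  rw [key, map_smul, norm_smul, Real.norm_of_nonneg hc0]
  exact (mul_le_of_le_one_left (norm_nonneg _) hc1).trans hg

end OrthGroup

namespace Gr

variable {n m : ℕ}

instance secondCountableTopology : SecondCountableTopology (Gr n m) :=
  (Topology.IsInducing.mk rfl :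
    Topology.IsInducing fun V : Gr n m => V.1.starProjection).secondCountableTopology

theorem continuous_starProjection : Continuous fun V : Gr n m => V.1.starProjection :=
  continuous_induced_dom

instance isFiniteMeasure_gamma (h : m ≤ n) : IsFiniteMeasure (gamma h) := by
  unfold gamma; infer_instance

theorem norm_proj (V : Gr n m) (x : EuclideanSpace ℝ (Fin n)) :
    ‖V.proj x‖ = ‖V.1.starProjection x‖ := rfl

theorem continuous_proj (V : Gr n m) : Continuous V.proj :=
  V.1.orthogonalProjectionOnto.continuous

theorem proj_sub (V : Gr n m) (x y : EuclideanSpace ℝ (Fin n)) :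
    V.proj (x - y) = V.proj x - V.proj y :=
  map_sub V.1.orthogonalProjectionOnto x y

theorem abs_apply_le_norm_starProjection_coord (h : m ≤ n) (w : EuclideanSpace ℝ (Fin n))
    (i : Fin n) (hi : i.1 < m) : |w i| ≤ ‖(coord h).1.starProjection w‖ := by
  have hmem : EuclideanSpace.single i (1 : ℝ) ∈ (coord h).1 :=
    Submodule.subset_span ⟨⟨i, hi⟩, rfl⟩
  have h1 : inner ℝ (EuclideanSpace.single i (1 : ℝ)) ((coord h).1.starProjection w) = w i := by
    have hself : (coord h).1.starProjection (EuclideanSpace.single i (1 : ℝ)) =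
        EuclideanSpace.single i (1 : ℝ) := Submodule.starProjection_eq_self_iff.2 hmem
    rw [← Submodule.inner_starProjection_left_eq_right (coord h).1, hself]
    simp [EuclideanSpace.inner_single_left]
  rw [← h1]
  simpa using abs_real_inner_le_norm (EuclideanSpace.single i (1 : ℝ))
    ((coord h).1.starProjection w)

theorem volume_closedBall_inter_slab_le (h : m ≤ n) (R r : ℝ) :
    volume {w : EuclideanSpace ℝ (Fin n) | ‖w‖ ≤ R ∧ ‖(coord h).1.starProjection w‖ ≤ r} ≤
      ENNReal.ofReal (2 * r) ^ m * ENNReal.ofReal (2 * R) ^ (n - m) := by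
  set a : Fin n → ℝ := fun i => if i.1 < m then r else R
  have hsub : {w : EuclideanSpace ℝ (Fin n) | ‖w‖ ≤ R ∧ ‖(coord h).1.starProjection w‖ ≤ r} ⊆
      WithLp.ofLp ⁻¹' Set.pi Set.univ fun i => Set.Icc (-a i) (a i) := by
    rintro w ⟨h1, h2⟩ i -
    refine abs_le.1 ?_
    by_cases hi : i.1 < m
    · simpa [a, hi] using (abs_apply_le_norm_starProjection_coord h w i hi).trans h2
    · simpa [a, hi] using (PiLp.norm_apply_le w i).trans h1
  refine (measure_mono hsub).trans ?_
  have hpi : MeasurableSet (Set.pi Set.univ fun i => Set.Icc (-a i) (a i)) :=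
    MeasurableSet.univ_pi fun i => measurableSet_Icc
  rw [(PiLp.volume_preserving_ofLp (Fin n)).measure_preimage hpi.nullMeasurableSet,
    volume_pi_pi]
  have hcard : (Finset.univ.filter fun i : Fin n => i.1 < m).card = m := by
    simp [Fin.card_filter_val_lt, h]
  have hcard' : (Finset.univ.filter fun i : Fin n => ¬ i.1 < m).card = n - m := by
    have := Finset.card_filter_add_card_filter_not (s := (Finset.univ : Finset (Fin n)))
      (fun i : Fin n => i.1 < m)
    simp only [hcard, Finset.card_univ, Fintype.card_fin] at this
    omega
  have heq : ∀ i : Fin n, volume (Set.Icc (-a i) (a i)) =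
      if i.1 < m then ENNReal.ofReal (2 * r) else ENNReal.ofReal (2 * R) := by
    intro i
    rw [Real.volume_Icc, sub_neg_eq_add, ← two_mul]
    split_ifs with hi <;> simp [a, hi]
  simp_rw [heq]
  rw [Finset.prod_ite, Finset.prod_const, Finset.prod_const, hcard, hcard']

theorem gamma_norm_starProjection_le (h : m ≤ n) {R : ℝ} (hR : 0 < R) :
    ∃ C : ℝ≥0∞, C ≠ ∞ ∧ ∀ v : EuclideanSpace ℝ (Fin n), R ≤ ‖v‖ → ∀ r : ℝ,
      gamma h {V | ‖V.1.starProjection v‖ ≤ r} ≤ C * ENNReal.ofReal r ^ m := by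
  set B : Set (EuclideanSpace ℝ (Fin n)) := Metric.closedBall 0 R
  have hB0 : volume B ≠ 0 := (Metric.measure_closedBall_pos volume _ hR).ne'
  have hBtop : volume B ≠ ∞ := measure_closedBall_lt_top.ne
  refine ⟨(volume B)⁻¹ * (2 ^ m * ENNReal.ofReal (2 * R) ^ (n - m)), by finiteness, ?_⟩
  intro v hv r
  have hclosed : IsClosed {V : Gr n m | ‖V.1.starProjection v‖ ≤ r} :=
    isClosed_le (continuous_starProjection.clm_apply continuous_const).norm continuous_const
  rw [gamma, Measure.map_apply (OrthGroup.continuous_act _).measurable hclosed.measurableSet]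
  simp only [Set.preimage_ofPred_eq, OrthGroup.norm_starProjection_act]
  set P := (coord h).1.starProjection
  set T : Set (OrthGroup n × EuclideanSpace ℝ (Fin n)) := {p | ‖P ((p.1⁻¹).1 p.2)‖ ≤ r}
  have hT : MeasurableSet T := by
    refine IsClosed.measurableSet (isClosed_le (P.continuous.comp ?_).norm continuous_const)
    exact (continuous_subtype_val.comp continuous_fst.inv).clm_apply continuous_snd
  have hprod : ((OrthGroup.haar n).prod (volume.restrict B)) T ≤
      ENNReal.ofReal (2 * r) ^ m * ENNReal.ofReal (2 * R) ^ (n - m) := by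
    rw [Measure.prod_apply hT]
    refine (lintegral_mono (g := fun _ =>
      ENNReal.ofReal (2 * r) ^ m * ENNReal.ofReal (2 * R) ^ (n - m)) fun g => ?_).trans (by simp)
    rw [Measure.restrict_apply (measurable_prodMk_left hT)]
    refine le_trans (le_of_eq ?_) (volume_closedBall_inter_slab_le h R r)
    have hA : MeasurableSet {w : EuclideanSpace ℝ (Fin n) | ‖w‖ ≤ R ∧ ‖P w‖ ≤ r} :=
      ((isClosed_le continuous_norm continuous_const).inter
        (isClosed_le P.continuous.norm continuous_const)).measurableSet
    rw [← (LinearIsometryEquiv.measurePreserving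
      (Unitary.linearIsometryEquiv g⁻¹)).measure_preimage hA.nullMeasurableSet]
    congr 1
    ext w
    change ‖P ((g⁻¹).1 w)‖ ≤ r ∧ w ∈ B ↔ ‖(g⁻¹).1 w‖ ≤ R ∧ ‖P ((g⁻¹).1 w)‖ ≤ r
    rw [mem_closedBall_zero_iff, and_comm,
      show ‖(g⁻¹).1 w‖ = ‖w‖ from Unitary.norm_map g⁻¹ w]
  have hlow : volume B * OrthGroup.haar n {g | ‖P ((g⁻¹).1 v)‖ ≤ r} ≤
      ((OrthGroup.haar n).prod (volume.restrict B)) T := by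
    rw [Measure.prod_apply_symm hT, mul_comm, ← setLIntegral_const]
    refine setLIntegral_mono' measurableSet_closedBall fun w hw => ?_
    exact OrthGroup.haar_norm_starProjection_le_mono _
      ((mem_closedBall_zero_iff.1 hw).trans hv) r
  have hfin := hlow.trans hprod
  rw [ENNReal.ofReal_mul zero_le_two, mul_pow, ENNReal.ofReal_ofNat] at hfin
  calc _ = (volume B)⁻¹ * (volume B * OrthGroup.haar n {g | ‖P ((g⁻¹).1 v)‖ ≤ r}) := by
        rw [← mul_assoc, ENNReal.inv_mul_cancel hB0 hBtop, one_mul]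
    _ ≤ (volume B)⁻¹ * (2 ^ m * ENNReal.ofReal r ^ m * ENNReal.ofReal (2 * R) ^ (n - m)) := by
        gcongr
    _ = _ := by ring

/-- The lower `m`-dimensional density, along dyadic radii, of `π_V ν` at `π_V x`. -/
noncomputable def lowerDensity (ν : Measure (EuclideanSpace ℝ (Fin n))) (V : Gr n m)
    (x : EuclideanSpace ℝ (Fin n)) : ℝ≥0∞ :=
  liminf (fun k : ℕ => 2 ^ (k * m) *
    ν {y | ‖V.1.starProjection (y - x)‖ ≤ (2 ^ k : ℝ)⁻¹}) atTop

theorem measurable_lowerDensity (ν : Measure (EuclideanSpace ℝ (Fin n))) [IsFiniteMeasure ν] :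
    Measurable fun p : Gr n m × EuclideanSpace ℝ (Fin n) => lowerDensity ν p.1 p.2 := by
  refine Measurable.liminf fun k => Measurable.const_mul ?_ _
  have hcl : IsClosed {q : (Gr n m × EuclideanSpace ℝ (Fin n)) × EuclideanSpace ℝ (Fin n) |
      ‖q.1.1.1.starProjection (q.2 - q.1.2)‖ ≤ (2 ^ k : ℝ)⁻¹} := by
    refine isClosed_le (Continuous.norm (Continuous.clm_apply ?_ ?_)) continuous_const
    · exact continuous_starProjection.comp (continuous_fst.comp continuous_fst)
    · exact continuous_snd.sub (continuous_snd.comp continuous_fst)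
  exact measurable_measure_prodMk_left hcl.measurableSet

theorem measurable_measure_norm_starProjection_sub_le (ν : Measure (EuclideanSpace ℝ (Fin n)))
    [IsFiniteMeasure ν] (x : EuclideanSpace ℝ (Fin n)) (r : ℝ) :
    Measurable fun V : Gr n m => ν {y | ‖V.1.starProjection (y - x)‖ ≤ r} := by
  have hcl : IsClosed {q : Gr n m × EuclideanSpace ℝ (Fin n) |
      ‖q.1.1.starProjection (q.2 - x)‖ ≤ r} :=
    isClosed_le (Continuous.norm ((continuous_starProjection.comp continuous_fst).clm_apply
      (continuous_snd.sub continuous_const))) continuous_const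
  exact measurable_measure_prodMk_left hcl.measurableSet

theorem lintegral_measure_norm_starProjection_sub_le (h : m ≤ n)
    (ν : Measure (EuclideanSpace ℝ (Fin n))) [IsFiniteMeasure ν] {x : EuclideanSpace ℝ (Fin n)}
    {r : ℝ} {K : ℝ≥0∞}
    (hK : ∀ᵐ y ∂ν, gamma h {V | ‖V.1.starProjection (y - x)‖ ≤ r} ≤ K) :
    ∫⁻ V, ν {y | ‖V.1.starProjection (y - x)‖ ≤ r} ∂gamma h ≤ K * ν Set.univ := by
  have hcl : IsClosed {q : Gr n m × EuclideanSpace ℝ (Fin n) |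
      ‖q.1.1.starProjection (q.2 - x)‖ ≤ r} :=
    isClosed_le (Continuous.norm ((continuous_starProjection.comp continuous_fst).clm_apply
      (continuous_snd.sub continuous_const))) continuous_const
  have h1 := Measure.prod_apply (μ := gamma h) (ν := ν) hcl.measurableSet
  rw [Measure.prod_apply_symm hcl.measurableSet] at h1
  refine h1.symm.le.trans ?_
  rw [← lintegral_const]
  exact lintegral_mono_ae hK

theorem two_pow_mul_ofReal_inv_two_pow (k m : ℕ) :
    (2 : ℝ≥0∞) ^ (k * m) * ENNReal.ofReal (2 ^ k : ℝ)⁻¹ ^ m = 1 := by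
  rw [ENNReal.ofReal_inv_of_pos (by positivity), ENNReal.ofReal_pow zero_le_two,
    ENNReal.ofReal_ofNat, pow_mul, ← mul_pow, ENNReal.mul_inv_cancel (by simp) (by finiteness),
    one_pow]

theorem ae_lowerDensity_lt_top (h : m ≤ n) (ν : Measure (EuclideanSpace ℝ (Fin n)))
    [IsFiniteMeasure ν] {x : EuclideanSpace ℝ (Fin n)} {R : ℝ} (hR : 0 < R)
    (hx : ∀ᵐ y ∂ν, R ≤ ‖y - x‖) : ∀ᵐ V ∂gamma h, lowerDensity ν V x < ∞ := by
  obtain ⟨C, hC, hbound⟩ := gamma_norm_starProjection_le h hR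
  have hint : ∀ k : ℕ, ∫⁻ V, 2 ^ (k * m) *
      ν {y | ‖V.1.starProjection (y - x)‖ ≤ (2 ^ k : ℝ)⁻¹} ∂gamma h ≤ C * ν Set.univ := by
    intro k
    rw [lintegral_const_mul _ (measurable_measure_norm_starProjection_sub_le ν x _)]
    have h2 := lintegral_measure_norm_starProjection_sub_le h ν (hx.mono fun y hy =>
      hbound (y - x) hy (2 ^ k : ℝ)⁻¹)
    refine (mul_le_mul_right h2 _).trans (le_of_eq ?_)
    rw [← mul_assoc, mul_left_comm, two_pow_mul_ofReal_inv_two_pow, mul_one]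
  have hfin : C * ν Set.univ ≠ ∞ := ENNReal.mul_ne_top hC (measure_ne_top ν _)
  have hmeas : Measurable fun V : Gr n m => lowerDensity ν V x :=
    Measurable.liminf fun k =>
      (measurable_measure_norm_starProjection_sub_le ν x _).const_mul _
  refine ae_lt_top hmeas (ne_top_of_le_ne_top hfin ?_)
  refine le_trans (lintegral_liminf_le fun k =>
    (measurable_measure_norm_starProjection_sub_le ν x _).const_mul _) ?_
  have hliminf : ∀ u : ℕ → ℝ≥0∞, (∀ k, u k ≤ C * ν Set.univ) →
      liminf u atTop ≤ C * ν Set.univ := fun u hu => by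
    simpa using liminf_le_liminf (Eventually.of_forall (f := (atTop : Filter ℕ)) hu)
  exact hliminf _ hint

theorem ae_lowerDensity_eq_top (V : Gr n m) (ν : Measure (EuclideanSpace ℝ (Fin n)))
    [IsFiniteMeasure ν] (hsing : V.projMeasure ν ⟂ₘ V.hausdorff) :
    ∀ᵐ x ∂ν, lowerDensity ν V x = ∞ := by
  have hV := V.2
  have hhaar : V.hausdorff.IsAddHaarMeasure := by
    have : V.hausdorff = Measure.hausdorffMeasure (Module.finrank ℝ V.1 : ℝ) := by
      rw [hV]; rfl
    rw [this]
    infer_instance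
  have : IsFiniteMeasure (V.projMeasure ν) := by unfold projMeasure; infer_instance
  have hae := (Besicovitch.ae_tendsto_rnDeriv V.hausdorff (V.projMeasure ν)).and
    (Measure.rnDeriv_eq_zero_of_mutuallySingular hsing.symm Measure.AbsolutelyContinuous.rfl)
  filter_upwards [ae_of_ae_map V.continuous_proj.aemeasurable hae] with x hx
  obtain ⟨hx1, hx2⟩ := hx
  rw [hx2] at hx1
  set c := V.hausdorff (Metric.closedBall 0 1)
  have hc0 : c ≠ 0 := (Metric.measure_closedBall_pos _ _ one_pos).ne'
  have hctop : c ≠ ∞ := measure_closedBall_lt_top.ne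
  have hr : Tendsto (fun k : ℕ => (2 ^ k : ℝ)⁻¹) atTop (𝓝[>] 0) :=
    tendsto_nhdsWithin_iff.2 ⟨tendsto_inv_atTop_zero.comp
      (tendsto_pow_atTop_atTop_of_one_lt one_lt_two), Eventually.of_forall fun k => by
        simp only [Set.mem_Ioi]; positivity⟩
  have hlim := (hx1.comp hr).inv
  have hlim2 := ENNReal.Tendsto.const_mul (a := c) hlim (Or.inl (by simp))
  simp only [Pi.zero_apply, ENNReal.inv_zero, ENNReal.mul_top hc0] at hlim2
  refine Tendsto.liminf_eq (hlim2.congr fun k => ?_)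
  have hball : V.hausdorff (Metric.closedBall (V.proj x) (2 ^ k : ℝ)⁻¹) =
      (2 ^ (k * m))⁻¹ * c := by
    rw [Measure.addHaar_closedBall' _ _ (by positivity), hV, inv_pow, ← pow_mul,
      ENNReal.ofReal_inv_of_pos (by positivity), ENNReal.ofReal_pow zero_le_two,
      ENNReal.ofReal_ofNat]
  have hpre : V.projMeasure ν (Metric.closedBall (V.proj x) (2 ^ k : ℝ)⁻¹) =
      ν {y | ‖V.1.starProjection (y - x)‖ ≤ (2 ^ k : ℝ)⁻¹} := by
    rw [projMeasure, Measure.map_apply V.continuous_proj.measurable measurableSet_closedBall]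
    congr 1
    ext y
    simp only [Set.mem_preimage, mem_closedBall_iff_norm, Set.mem_ofPred_eq, ← norm_proj, proj_sub]
  simp only [Function.comp_apply]
  rw [hball, hpre, ENNReal.inv_div (Or.inr (by finiteness)) (Or.inr (by simp [hc0])),
    ENNReal.div_eq_inv_mul, ENNReal.mul_inv (by simp) (by simp), inv_inv, ← mul_assoc,
    mul_left_comm, ENNReal.mul_inv_cancel hc0 hctop, mul_one]

theorem lowerDensity_congr {ν : Measure (EuclideanSpace ℝ (Fin n))} {V : Gr n m}
    {x y : EuclideanSpace ℝ (Fin n)} (h : V.proj x = V.proj y) :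
    lowerDensity ν V x = lowerDensity ν V y := by
  simp only [lowerDensity, ← norm_proj, proj_sub, h]

theorem ae_ae_lowerDensity_restrict_ball_lt_top (h : m ≤ n)
    (μ : Measure (EuclideanSpace ℝ (Fin n))) [IsFiniteMeasure μ]
    (b : EuclideanSpace ℝ (Fin n)) {R : ℝ} (hR : 0 < R) :
    ∀ᵐ V ∂gamma h, ∀ᵐ x ∂μ, 2 * R ≤ dist x b →
      lowerDensity (μ.restrict (Metric.ball b R)) V x < ∞ := by
  refine (Measure.ae_ae_comm ?_).2 (Eventually.of_forall fun x => ?_)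
  · refine MeasurableSet.imp ?_ (measurableSet_lt (measurable_lowerDensity _) measurable_const)
    exact measurableSet_le measurable_const (measurable_snd.dist measurable_const)
  · by_cases hx : 2 * R ≤ dist x b
    · have := ae_lowerDensity_lt_top h (μ.restrict (Metric.ball b R)) (x := x) hR (by
        filter_upwards [ae_restrict_mem measurableSet_ball] with y hy
        rw [← dist_eq_norm]
        have h1 := dist_triangle x y b
        rw [Metric.mem_ball] at hy
        rw [dist_comm x y] at h1
        linarith)
      filter_upwards [this] with V hV _ using hV
    · exact Eventually.of_forall fun V hx' => absurd hx' hx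

theorem ae_injOnFullMeasure (h : m ≤ n) (μ : Measure (EuclideanSpace ℝ (Fin n)))
    [IsFiniteMeasure μ] :
    ∀ᵐ V ∂gamma h, V.projMeasure μ ⟂ₘ V.hausdorff → V.InjOnFullMeasure μ := by
  set b := TopologicalSpace.denseSeq (EuclideanSpace ℝ (Fin n))
  set R : ℕ → ℝ := fun k => 1 / ((k : ℝ) + 1)
  have hR : ∀ k, 0 < R k := fun k => Nat.one_div_pos_of_nat
  have hall : ∀ᵐ V ∂gamma h, ∀ i k : ℕ, ∀ᵐ x ∂μ, 2 * R k ≤ dist x (b i) →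
      lowerDensity (μ.restrict (Metric.ball (b i) (R k))) V x < ∞ := by
    simp only [ae_all_iff]
    exact fun i k => ae_ae_lowerDensity_restrict_ball_lt_top h μ (b i) (hR k)
  filter_upwards [hall] with V hV hsing
  have htop : ∀ i k : ℕ, ∀ᵐ x ∂μ, x ∈ Metric.ball (b i) (R k) →
      lowerDensity (μ.restrict (Metric.ball (b i) (R k))) V x = ∞ := fun i k =>
    (ae_restrict_iff' measurableSet_ball).1 (ae_lowerDensity_eq_top V _ (hsing.mono_ac
      (Measure.absolutelyContinuous_of_le (Measure.map_mono Measure.restrict_le_self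
        V.continuous_proj.measurable)) Measure.AbsolutelyContinuous.rfl))
  have hgood : ∀ᵐ x ∂μ, ∀ i k : ℕ, (2 * R k ≤ dist x (b i) →
      lowerDensity (μ.restrict (Metric.ball (b i) (R k))) V x < ∞) ∧
      (x ∈ Metric.ball (b i) (R k) →
        lowerDensity (μ.restrict (Metric.ball (b i) (R k))) V x = ∞) := by
    simp only [ae_all_iff]
    exact fun i k => (hV i k).and (htop i k)
  obtain ⟨E, hE, hEm, hE0⟩ := hgood.exists_measurable_mem
  refine ⟨E, hEm, hE, fun x hx y hy hxy => by_contra fun hne => ?_⟩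
  obtain ⟨k, hk⟩ := exists_nat_one_div_lt (K := ℝ) (div_pos (dist_pos.2 hne) three_pos)
  change R k < _ at hk
  obtain ⟨i, hi⟩ := (TopologicalSpace.denseRange_denseSeq _).exists_dist_lt y (hR k)
  change dist y (b i) < _ at hi
  have h1 := dist_triangle x (b i) y
  rw [dist_comm (b i) y] at h1
  have hlt := (hE0 x hx i k).1 (by linarith)
  rw [lowerDensity_congr hxy, (hE0 y hy i k).2 hi] at hlt
  exact lt_irrefl _ hlt

theorem projMeasure_mutuallySingular_of_acPart_eq_zero (V : Gr n m)
    (μ : Measure (EuclideanSpace ℝ (Fin n))) [IsFiniteMeasure μ] (h : V.acPart μ = 0) :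
    V.projMeasure μ ⟂ₘ V.hausdorff := by
  have : IsFiniteMeasure (V.projMeasure μ) := by unfold projMeasure; infer_instance
  have hadd := Measure.singularPart_add_rnDeriv (V.projMeasure μ) V.hausdorff
  rw [acPart] at h
  rw [h, add_zero] at hadd
  rw [← hadd]
  exact Measure.mutuallySingular_singularPart _ _

end Gr

theorem theorem1p3 (n m : ℕ) (hm : 0 < m) (hmn : m < n)
    (μ : Measure (EuclideanSpace ℝ (Fin n))) [IsFiniteMeasure μ]
    (S : Set (Gr n m)) (hS : MeasurableSet S) :
    ((∀ᵐ V ∂(Gr.gamma hmn.le), V ∈ S → V.InjOnFullMeasure μ) ∨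
      0 < Gr.gamma hmn.le {V | V ∈ S ∧ V.acPart μ ≠ 0}) ∧
    ((∀ᵐ V ∂(Gr.gamma hmn.le), V ∈ S → V.projMeasure μ ⟂ₘ V.hausdorff) →
      ∀ᵐ V ∂(Gr.gamma hmn.le), V ∈ S → V.InjOnFullMeasure μ) := by
  have key : (∀ᵐ V ∂(Gr.gamma hmn.le), V ∈ S → V.projMeasure μ ⟂ₘ V.hausdorff) →
      ∀ᵐ V ∂(Gr.gamma hmn.le), V ∈ S → V.InjOnFullMeasure μ := fun h => by
    filter_upwards [h, Gr.ae_injOnFullMeasure hmn.le μ] with V h1 h2 hVS using h2 (h1 hVS)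
  refine ⟨or_iff_not_imp_right.2 fun h => key ?_, key⟩
  have h0 : ∀ᵐ V ∂(Gr.gamma hmn.le), ¬ (V ∈ S ∧ V.acPart μ ≠ 0) := by
    simpa [ae_iff] using h
  filter_upwards [h0] with V hV hVS
  exact V.projMeasure_mutuallySingular_of_acPart_eq_zero μ (by_contra fun hne => hV ⟨hVS, hne⟩)
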